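/- Let $K$ be a field with a valuation (of arbitrary rank, possibly trivial) whose valuation ring $R$ is Henselian, let $\mathfrak m$ be the maximal ideal of $R$, and equip $R$ with the valuation topology, and subsets of powers of $R$ with the topologies induced from the product topologies. Let $0\le r<n$ and let $p=(p_{r+1},\dots,p_n)$ be polynomials in $R[X_1,\dots,X_n]$. Put $$V:=\{x\in R^n:\ p_{r+1}(x)=\dots=p_n(x)=0\},\qquad J:=\det\left(\frac{\partial p_i}{\partial X_j}\right)_{r+1\le i,j\le n},\qquad e:=J(\mathbf 0),$$ and suppose that $\mathbf 0\in V$ and $e\neq 0$. Then there is a continuous map $$\phi:(e^2\mathfrak m)^{r}\to(e\,\mathfrak m)^{n-r}$$ (Cartesian powers of the ideals $e^2\mathfrak m=\{e^2x: x\in\mathfrak m\}$ and $e\,\mathfrak m$) such that $\phi(\mathbf 0)=\mathbf 0$, $(u,\phi(u))\in V$ for every $u\in(e^2\mathfrak m)^r$, and the graph map $u\mapsto(u,\phi(u))$ is an open embedding of $(e^2\mathfrak m)^r$ into $V$, i.e. a homeomorphism onto an open subset of $V$. -/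

import Mathlib

open scoped Valued Pointwise

namespace HenselianIFT

/-- The common zero locus `V = {x ∈ R^n : p_j(x) = 0 for all j}` of a family of polynomials,
as a subset of `R^n`. -/
def zeroLocus {R : Type*} [CommRing R] {n s : ℕ} (p : Fin s → MvPolynomial (Fin n) R) :
    Set (Fin n → R) :=
  {x | ∀ j, MvPolynomial.eval x (p j) = 0}

/-- The Jacobian minor of `s` polynomials in the `r + s` variables `X_1, …, X_{r+s}` with respect
to the last `s` variables `X_{r+1}, …, X_{r+s}`, as a polynomial. -/
noncomputable def jacobianMinor {R : Type*} [CommRing R] {r s : ℕ}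
    (p : Fin s → MvPolynomial (Fin (r + s)) R) : MvPolynomial (Fin (r + s)) R :=
  (Matrix.of fun i j : Fin s => MvPolynomial.pderiv (Fin.natAdd r j) (p i)).det

/-- The point `(u, w) ∈ R^{r+s}` with first block of coordinates `u ∈ I^r` and second block
`w ∈ J^s`, for ideals `I`, `J` of `R`. -/
def joinPoint {R : Type*} [CommRing R] {I J : Ideal R} {r s : ℕ}
    (u : Fin r → I) (w : Fin s → J) : Fin (r + s) → R :=
  Fin.append (fun i => (u i : R)) (fun j => (w j : R))

end HenselianIFT

/-! Fix `u` in `(e² 𝔪)^r` and rescale the unknowns as `y = e z`. With `A` the Jacobian matrix at the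
origin, `adj A * A = e`, so multiplying the Taylor expansion of `p(u, e z)` by `adj A` makes it
divisible by `e²`. The quotient is a system whose Jacobian at `z = 0` is the identity modulo `𝔪`;
multivariate Hensel gives a zero in `𝔪^s` (`exists_solution`). That lemma reduces to the
one-variable one because étale algebras are locally standard étale. For two solutions in the box,
the mean value matrix has determinant `e` times a unit, so `e (w - w')` is an `R`-combination of the
`u i - u' i` (`exists_mul_sub_eq_sum`). This gives uniqueness and continuity; by uniqueness the
graph is `V` intersected with an open box. -/

namespace HenselianIFT

open IsLocalRing MvPolynomial

/-! ### Multivariate Hensel via étale algebras -/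

section Etale

/-- Sections of étale algebras over the residue field of a Henselian local ring lift. -/
theorem exists_algHom_residue_eq {R S : Type*} [CommRing R] [HenselianLocalRing R] [CommRing S]
    [Algebra R S] [Algebra.Etale R S] (f : S →ₐ[R] ResidueField R) :
    ∃ g : S →ₐ[R] R, ∀ x, residue R (g x) = f x := by
  have hprime : (RingHom.ker f).IsPrime := RingHom.ker_isPrime f
  -- As `t` lies outside `ker f`, `f` extends to the localization at `t`, which is generated by a
  -- simple root of a monic polynomial.
  obtain ⟨t, ht, hstd⟩ := Algebra.IsEtaleAt.exists_isStandardEtale (R := R) (RingHom.ker f)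
  obtain ⟨P⟩ := hstd.nonempty_standardEtalePresentation
  have htu : IsUnit (f t) := isUnit_iff_ne_zero.mpr ht
  let f' : Localization.Away t →ₐ[R] ResidueField R := IsLocalization.Away.liftAlgHom t htu
  have hf' : ∀ x, f' (algebraMap S _ x) = f x := fun x =>
    IsLocalization.Away.lift_eq t htu x
  obtain ⟨a₀, ha₀⟩ := residue_surjective (f' P.x)
  have haeval : ∀ (b : R) (F : Polynomial R),
      Polynomial.aeval (residue R b) F = residue R (F.eval b) := fun b F => by
    rw [Polynomial.aeval_def, ResidueField.algebraMap_eq, Polynomial.eval₂_at_apply]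
  have hx := P.hasMap.map f'
  rw [← ha₀] at hx
  have hd := hx.isUnit_derivative_f
  have h0 := hx.1
  rw [haeval] at hd h0
  obtain ⟨a, ha, haa⟩ := HenselianLocalRing.is_henselian P.f P.monic_f a₀
    ((residue_eq_zero_iff _).mp h0) (isUnit_of_map_unit (residue R) _ hd)
  have hares : residue R a = f' P.x := by
    rw [← ha₀, ← sub_eq_zero, ← map_sub]
    exact (residue_eq_zero_iff _).mpr haa
  have hmap : P.HasMap a := by
    refine ⟨by simpa [Polynomial.aeval_def] using ha, ?_⟩
    have h2 := hx.2
    rw [ha₀, ← hares, haeval] at h2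
    simpa [Polynomial.aeval_def] using isUnit_of_map_unit (residue R) _ h2
  let g' : Localization.Away t →ₐ[R] R := (P.lift a hmap).comp P.equivRing.toAlgHom
  have hg' : (Algebra.ofId R (ResidueField R)).comp g' = f' := by
    refine P.hom_ext ?_
    simpa [g', Algebra.ofId_apply] using hares
  refine ⟨g'.comp (IsScalarTower.toAlgHom R S (Localization.Away t)), fun x => ?_⟩
  rw [← hf', ← hg']
  rfl

/-- The algebra obtained from a presentation with as many relations as variables by inverting the
Jacobian determinant is étale. -/
theorem etale_of_isLocalizationAway_jacobian {R A ι σ : Type*} [CommRing R] [CommRing A]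
    [Algebra R A] [Finite ι] [Finite σ] (P : Algebra.PreSubmersivePresentation R A ι σ)
    (hcard : Nat.card ι = Nat.card σ) (T : Type*) [CommRing T] [Algebra A T] [Algebra R T]
    [IsScalarTower R A T] [IsLocalization.Away P.jacobian T] : Algebra.Etale R T := by
  -- Inverting the Jacobian adds one variable and one relation; the new Jacobian is the square of
  -- the old one in `T`, hence a unit.
  let Q := (Algebra.PreSubmersivePresentation.localizationAway T P.jacobian).comp P
  have hQ : IsUnit Q.jacobian := by
    rw [Algebra.PreSubmersivePresentation.comp_jacobian_eq_jacobian_smul_jacobian,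
      Algebra.PreSubmersivePresentation.localizationAway_jacobian, Algebra.smul_def]
    have := IsLocalization.Away.algebraMap_isUnit (S := T) P.jacobian
    exact this.mul this
  let Q' : Algebra.SubmersivePresentation R T (Unit ⊕ ι) (Unit ⊕ σ) := ⟨Q, hQ⟩
  have : Algebra.IsStandardSmoothOfRelativeDimension 0 R T :=
    Q'.isStandardSmoothOfRelativeDimension <| by
      simp [Algebra.Presentation.dimension, hcard, Nat.card_sum]
  infer_instance

/-- The multivariate Hensel lemma. -/
theorem exists_eval_eq_zero {R : Type*} [CommRing R] [HenselianLocalRing R] {σ : Type*} [Fintype σ]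
    [DecidableEq σ] (q : σ → MvPolynomial σ R) (a : σ → R)
    (h : ∀ i, eval a (q i) ∈ maximalIdeal R)
    (hJ : IsUnit (Matrix.of fun i j : σ => eval a (pderiv j (q i))).det) :
    ∃ z : σ → R, (∀ i, eval z (q i) = 0) ∧ ∀ i, z i - a i ∈ maximalIdeal R := by
  let P := Algebra.PreSubmersivePresentation.naive (v := q) id Function.injective_id
  have : Algebra.Etale R (Localization.Away P.jacobian) :=
    etale_of_isLocalizationAway_jacobian P rfl _
  have haeval : ∀ F : MvPolynomial σ R,
      aeval (fun i => residue R (a i)) F = residue R (eval a F) := fun F => by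
    rw [aeval_def, ResidueField.algebraMap_eq]
    exact (eval₂_comp (residue R) a F).symm
  let f₀ : (MvPolynomial σ R ⧸ Ideal.span (Set.range q)) →ₐ[R] ResidueField R :=
    Ideal.Quotient.liftₐ _ (aeval fun i => residue R (a i)) <| by
      intro F hF
      refine (Ideal.span_le (I := RingHom.ker (aeval fun i => residue R (a i)))).mpr ?_ hF
      rintro _ ⟨i, rfl⟩
      simpa [haeval] using h i
  have hf₀ : ∀ F, f₀ (Ideal.Quotient.mk _ F) = residue R (eval a F) := haeval
  have hu : IsUnit (f₀ P.jacobian) := by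
    rw [P.jacobian_eq_jacobiMatrix_det]
    change IsUnit (f₀ (Ideal.Quotient.mk _ P.jacobiMatrix.det))
    rw [hf₀, RingHom.map_det, ← Matrix.det_transpose]
    convert hJ.map (residue R) using 3
    ext i j
    simp [P]
  let f : Localization.Away P.jacobian →ₐ[R] ResidueField R :=
    IsLocalization.Away.liftAlgHom P.jacobian hu
  obtain ⟨g, hg⟩ := exists_algHom_residue_eq f
  let g₀ : MvPolynomial σ R →ₐ[R] R :=
    (g.comp (IsScalarTower.toAlgHom R (MvPolynomial σ R ⧸ Ideal.span (Set.range q))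
      (Localization.Away P.jacobian))).comp
      (Ideal.Quotient.mkₐ R (Ideal.span (Set.range q)))
  have hg₀ : ∀ F, eval (fun i => g₀ (X i)) F = g₀ F := fun F => by
    rw [← coe_aeval_eq_eval, RingHom.coe_coe]
    exact (DFunLike.congr_fun (aeval_unique g₀) F).symm
  refine ⟨fun i => g₀ (X i), fun i => ?_, fun i => ?_⟩
  · rw [hg₀]
    have : Ideal.Quotient.mkₐ R (Ideal.span (Set.range q)) (q i) = 0 :=
      Ideal.Quotient.eq_zero_iff_mem.mpr (Ideal.subset_span ⟨i, rfl⟩)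
    simp only [g₀, AlgHom.comp_apply, this, map_zero]
  · rw [← residue_eq_zero_iff, map_sub, sub_eq_zero]
    refine (hg _).trans ?_
    refine (IsLocalization.Away.lift_eq P.jacobian hu _).trans ?_
    exact (hf₀ _).trans (by simp)

end Etale

/-! ### Polynomial Taylor expansions -/

section Taylor

variable {R : Type*} [CommRing R] {σ : Type*} [Fintype σ]

theorem eval_sub_eval_zero_mem {σ : Type*} (I : Ideal R) {x : σ → R} (hx : ∀ i, x i ∈ I)
    (P : MvPolynomial σ R) : eval x P - eval 0 P ∈ I := by
  rw [← Ideal.Quotient.eq]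
  have : (Ideal.Quotient.mk I).comp (eval x) = (Ideal.Quotient.mk I).comp (eval 0) :=
    ringHom_ext (by simp) fun j => by simpa using Ideal.Quotient.eq_zero_iff_mem.mpr (hx j)
  exact DFunLike.congr_fun this P

/-- The mean value theorem for polynomials, with control of the coefficients modulo an ideal. -/
theorem exists_eval_sub_eval_eq_sum (I : Ideal R) {x y : σ → R} (hx : ∀ i, x i ∈ I)
    (hy : ∀ i, y i ∈ I) (P : MvPolynomial σ R) :
    ∃ N : σ → R, eval x P - eval y P = ∑ j, N j * (x j - y j) ∧
      ∀ j, N j - eval 0 (pderiv j P) ∈ I := by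
  classical
  induction P using MvPolynomial.induction_on with
  | C a => exact ⟨0, by simp⟩
  | add P Q hP hQ =>
    obtain ⟨N, hN, hN'⟩ := hP
    obtain ⟨M, hM, hM'⟩ := hQ
    refine ⟨N + M, ?_, fun j => ?_⟩
    · simp only [map_add, Pi.add_apply, add_mul, Finset.sum_add_distrib, ← hN, ← hM]
      ring
    · convert I.add_mem (hN' j) (hM' j) using 1
      simp only [map_add, Pi.add_apply]
      ring
  | mul_X P i hP =>
    obtain ⟨N, hN, -⟩ := hP
    -- From `P(x) x_i - P(y) y_i = (P(x) - P(y)) y_i + P(x) (x_i - y_i)`.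
    refine ⟨fun j => N j * y i + (Pi.single i (eval x P) : σ → R) j, ?_, fun j => ?_⟩
    · simp only [map_mul, eval_X, add_mul, Finset.sum_add_distrib]
      have : ∑ j, N j * y i * (x j - y j) = (∑ j, N j * (x j - y j)) * y i := by
        rw [Finset.sum_mul]
        exact Finset.sum_congr rfl fun j _ => by ring
      rw [this, ← hN]
      simp only [Pi.single_apply, ite_mul, zero_mul, Finset.sum_ite_eq', Finset.mem_univ, if_true]
      ring
    · have : N j * y i + (Pi.single i (eval x P) : σ → R) j - eval 0 (pderiv j (P * X i)) =
          N j * y i + (Pi.single i (eval x P - eval 0 P) : σ → R) j := by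
        by_cases hij : j = i
        · subst hij
          simp
          ring
        · simp [pderiv_X, hij, Ne.symm hij]
      rw [this]
      refine I.add_mem (I.mul_mem_left _ (hy i)) ?_
      by_cases hij : j = i
      · subst hij; simpa using eval_sub_eval_zero_mem I hx P
      · simp [hij]

/-- Second order Taylor expansion of `P(e Y)` at the origin. -/
theorem exists_aeval_C_mul_X_eq (e : R) (P : MvPolynomial σ R) :
    ∃ Q : MvPolynomial σ R, eval 0 Q = 0 ∧ (∀ j, eval 0 (pderiv j Q) = 0) ∧
      aeval (fun j => C e * X j : σ → MvPolynomial σ R) P =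
        C (eval 0 P) + C e * ∑ j, C (eval 0 (pderiv j P)) * X j + C (e ^ 2) * Q := by
  classical
  induction P using MvPolynomial.induction_on with
  | C a => exact ⟨0, by simp [algebraMap_eq]⟩
  | add P Q hP hQ =>
    obtain ⟨N, h1, h2, hN⟩ := hP
    obtain ⟨M, h3, h4, hM⟩ := hQ
    refine ⟨N + M, by rw [map_add, h1, h3, add_zero], fun j => by rw [map_add, map_add, h2, h4, add_zero], ?_⟩
    simp only [map_add, hN, hM, add_mul, Finset.sum_add_distrib]
    ring
  | mul_X P i hP =>
    obtain ⟨N, h1, h2, hN⟩ := hP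
    -- The part of order at least two after multiplying by `e X_i`, with `e²` taken out.
    refine ⟨(∑ j, C (eval 0 (pderiv j P)) * X j + C e * N) * X i, by simp, ?_, ?_⟩
    · intro j
      simp only [pderiv_mul, map_add, map_mul, eval_X, Pi.zero_apply, mul_zero, h1, map_sum,
        Finset.sum_const_zero, add_zero, zero_mul]
    · have : ∀ j, eval 0 (pderiv j (P * X i)) = (Pi.single i (eval 0 P) : σ → R) j := by
        intro j
        by_cases hij : j = i
        · subst hij; simp
        · simp [pderiv_X, hij, Ne.symm hij]
      simp only [this, map_mul, aeval_X, hN, Pi.single_apply, apply_ite C, map_zero, ite_mul,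
        zero_mul, Finset.sum_ite_eq', Finset.mem_univ, if_true, eval_X, Pi.zero_apply, mul_zero,
        map_pow]
      ring

end Taylor

/-! ### Existence and rigidity of solutions -/

section Algebra

theorem det_sub_det_mem {R n : Type*} [CommRing R] [Fintype n] [DecidableEq n] (I : Ideal R)
    {M N : Matrix n n R} (h : ∀ i j, M i j - N i j ∈ I) : M.det - N.det ∈ I := by
  rw [← Ideal.Quotient.eq, RingHom.map_det, RingHom.map_det]
  congr 1
  ext i j
  exact Ideal.Quotient.eq.mpr (h i j)

theorem append_mem {R : Type*} [CommRing R] {I : Ideal R} {r s : ℕ} {u : Fin r → R}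
    {w : Fin s → R} (hu : ∀ i, u i ∈ I) (hw : ∀ j, w j ∈ I) (k : Fin (r + s)) :
    Fin.append u w k ∈ I := by
  induction k using Fin.addCases with
  | left i => simpa using hu i
  | right j => simpa using hw j

theorem mem_smul_ideal {R : Type*} [CommRing R] {a x : R} {I : Ideal R} :
    x ∈ a • I ↔ ∃ y ∈ I, a * y = x := by
  simp [Submodule.mem_smul_pointwise_iff_exists]

theorem sq_smul_le {R : Type*} [CommRing R] (e : R) (I : Ideal R) : e ^ 2 • I ≤ e • I := by
  intro x hx
  obtain ⟨y, hy, rfl⟩ := mem_smul_ideal.mp hx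
  exact mem_smul_ideal.mpr ⟨e * y, I.mul_mem_left _ hy, by ring⟩

variable {R : Type*} [CommRing R] {r s : ℕ}

/-- Substitution of the values `u` for the first block of variables. -/
noncomputable def substFirst (u : Fin r → R) :
    MvPolynomial (Fin (r + s)) R →ₐ[R] MvPolynomial (Fin s) R :=
  aeval (Fin.append (fun i => C (u i)) X)

theorem eval_substFirst (u : Fin r → R) (y : Fin s → R) (P : MvPolynomial (Fin (r + s)) R) :
    eval y (substFirst u P) = eval (Fin.append u y) P := by
  have : (eval y).comp (substFirst u).toRingHom = eval (Fin.append u y) := by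
    refine ringHom_ext (by simp [substFirst, algebraMap_eq]) fun k => ?_
    induction k using Fin.addCases <;> simp [substFirst]
  exact DFunLike.congr_fun this P

theorem pderiv_substFirst (u : Fin r → R) (j : Fin s) (P : MvPolynomial (Fin (r + s)) R) :
    pderiv j (substFirst u P) = substFirst u (pderiv (Fin.natAdd r j) P) := by
  induction P using MvPolynomial.induction_on with
  | C a => simp [substFirst, algebraMap_eq]
  | add P Q hP hQ => simp [hP, hQ]
  | mul_X P k hP =>
    rw [map_mul, pderiv_mul, pderiv_mul, hP, map_add, map_mul, map_mul]
    congr 2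
    induction k using Fin.addCases with
    | left i =>
      rw [pderiv_X_of_ne]
      · simp [substFirst]
      · intro h
        have := congrArg Fin.val h
        simp at this
        omega
    | right i =>
      by_cases hij : i = j
      · subst hij; simp [substFirst]
      · rw [pderiv_X_of_ne (by simpa using hij)]
        simp [substFirst, pderiv_X_of_ne hij]

theorem eval_zero_jacobianMinor (p : Fin s → MvPolynomial (Fin (r + s)) R) :
    eval 0 (jacobianMinor p) =
      (Matrix.of fun i j : Fin s => eval 0 (pderiv (Fin.natAdd r j) (p i))).det := by
  rw [jacobianMinor, RingHom.map_det]
  rfl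

/-- Over the fibre of `u ∈ (e² 𝔪)^r` there is a solution in `(e 𝔪)^s`. -/
theorem exists_solution [IsDomain R] [HenselianLocalRing R]
    (p : Fin s → MvPolynomial (Fin (r + s)) R) (hp : ∀ i, eval 0 (p i) = 0) {e : R}
    (he : e = eval 0 (jacobianMinor p)) (he0 : e ≠ 0) (u : Fin r → R)
    (hu : ∀ i, u i ∈ e ^ 2 • maximalIdeal R) :
    ∃ w : Fin s → R, (∀ j, w j ∈ e • maximalIdeal R) ∧
      ∀ i, eval (Fin.append u w) (p i) = 0 := by
  set A : Matrix (Fin s) (Fin s) R :=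
    Matrix.of fun i j => eval 0 (pderiv (Fin.natAdd r j) (p i))
  have hdet : A.det = e := by rw [he, eval_zero_jacobianMinor]
  have hu0 : ∀ k, Fin.append u (0 : Fin s → R) k ∈ e ^ 2 • maximalIdeal R :=
    append_mem hu fun _ => Submodule.zero_mem _
  -- `(u, 0)` vanishes modulo `e² 𝔪`, so moving from the origin to it changes values and derivatives
  -- by `e² c` and `e² b`.
  have hc : ∀ k, ∃ y ∈ maximalIdeal R, e ^ 2 * y = eval 0 (substFirst u (p k)) := fun k => by
    rw [← mem_smul_ideal, eval_substFirst]
    have := eval_sub_eval_zero_mem _ hu0 (p k)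
    rwa [hp, sub_zero] at this
  have hb : ∀ k j, ∃ y ∈ maximalIdeal R,
      e ^ 2 * y = eval 0 (pderiv j (substFirst u (p k))) - A k j := fun k j => by
    rw [← mem_smul_ideal, pderiv_substFirst, eval_substFirst]
    exact eval_sub_eval_zero_mem _ hu0 _
  choose c hcm hc using hc
  choose b hbm hb using hb
  choose Q hQ0 hQ1 hQ using fun k => exists_aeval_C_mul_X_eq e (substFirst u (p k))
  -- This is `e⁻² adj(A) p(u, e X)`.
  let q : Fin s → MvPolynomial (Fin s) R := fun i =>
    ∑ k, C (A.adjugate i k) * (C (c k) + Q k) + X i +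
      ∑ k, ∑ j, C (e * A.adjugate i k * b k j) * X j
  have hq0 : ∀ i, eval 0 (q i) ∈ maximalIdeal R := fun i => by
    have : eval 0 (q i) = ∑ k, A.adjugate i k * c k := by
      simp only [q, map_add, map_sum, map_mul, eval_C, eval_X, hQ0, Pi.zero_apply, mul_zero,
        Finset.sum_const_zero, add_zero]
    rw [this]
    exact Ideal.sum_mem _ fun k _ => Ideal.mul_mem_left _ _ (hcm k)
  have hq1 : ∀ i j, eval 0 (pderiv j (q i)) - (1 : Matrix (Fin s) (Fin s) R) i j ∈
      maximalIdeal R := fun i j => by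
    have : eval 0 (pderiv j (q i)) =
        (1 : Matrix (Fin s) (Fin s) R) i j + ∑ k, e * A.adjugate i k * b k j := by
      simp only [q, map_add, map_sum, pderiv_mul, pderiv_C, map_mul, eval_C, zero_add, zero_mul,
        hQ1, mul_zero, Finset.sum_const_zero, pderiv_X, Pi.single_apply, Matrix.one_apply,
        apply_ite (eval (0 : Fin s → R)), map_one, map_zero, mul_ite, mul_one,
        Finset.sum_ite_eq, Finset.mem_univ, if_true, eq_comm]
    rw [this, add_sub_cancel_left]
    exact Ideal.sum_mem _ fun k _ => Ideal.mul_mem_left _ _ (hbm k j)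
  have hunit : IsUnit (Matrix.of fun i j : Fin s => eval 0 (pderiv j (q i))).det := by
    have h1 := det_sub_det_mem (maximalIdeal R)
      (M := Matrix.of fun i j : Fin s => eval 0 (pderiv j (q i))) (N := 1) hq1
    rw [Matrix.det_one] at h1
    by_contra hn
    have := (maximalIdeal R).sub_mem ((mem_maximalIdeal _).mpr hn) h1
    rw [sub_sub_cancel] at this
    exact (mem_maximalIdeal _).mp this isUnit_one
  obtain ⟨z, hz, hzm⟩ := exists_eval_eq_zero q 0 hq0 hunit
  refine ⟨fun j => e * z j, fun j => mem_smul_ideal.mpr ⟨z j, by simpa using hzm j, rfl⟩, ?_⟩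
  set v : Fin s → R := fun i => eval (Fin.append u fun j => e * z j) (p i) with hv
  have hvk : ∀ k, v k = e ^ 2 * c k + e * ∑ j, (A k j + e ^ 2 * b k j) * z j
      + e ^ 2 * eval z (Q k) := fun k => by
    have h1 : v k = eval z (aeval (fun j => C e * X j : Fin s → MvPolynomial (Fin s) R)
        (substFirst u (p k))) := by
      simp only [hv]
      rw [← eval_substFirst]
      have : (eval z).comp (aeval (fun j => C e * X j : Fin s → MvPolynomial (Fin s) R)).toRingHom
          = eval fun j => e * z j := ringHom_ext (by simp [algebraMap_eq]) (by simp)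
      exact (DFunLike.congr_fun this _).symm
    rw [h1, hQ k]
    simp only [map_add, map_mul, map_sum, eval_C, eval_X, hc, hb, add_sub_cancel]
  have hadj : ∀ i j, ∑ k, A.adjugate i k * A k j = e * (1 : Matrix (Fin s) (Fin s) R) i j := by
    intro i j
    rw [← Matrix.mul_apply, Matrix.adjugate_mul, hdet, Matrix.smul_apply, smul_eq_mul]
  have hzero : A.adjugate.mulVec v = 0 := by
    ext i
    have h2 : (A.adjugate.mulVec v) i = e ^ 2 * eval z (q i) := by
      have h3 : ∑ k, A.adjugate i k * (e * ∑ j, A k j * z j) = e ^ 2 * z i := by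
        simp only [Finset.mul_sum]
        rw [Finset.sum_comm]
        have : ∀ j, ∑ k, A.adjugate i k * (e * (A k j * z j)) =
            e * (∑ k, A.adjugate i k * A k j) * z j := fun j => by
          rw [Finset.mul_sum, Finset.sum_mul]
          exact Finset.sum_congr rfl fun k _ => by ring
        simp only [this, hadj, Matrix.one_apply, mul_ite, mul_one, mul_zero, ite_mul, zero_mul,
          Finset.sum_ite_eq, Finset.mem_univ, if_true]
        ring
      simp only [Matrix.mulVec, dotProduct, hvk, q, map_add, map_mul, map_sum, eval_C, eval_X]
      rw [mul_add, mul_add, ← h3, Finset.mul_sum, Finset.mul_sum, ← Finset.sum_add_distrib,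
        ← Finset.sum_add_distrib]
      refine Finset.sum_congr rfl fun k _ => ?_
      have h4 : ∑ j, e * A.adjugate i k * b k j * z j = e * A.adjugate i k * ∑ j, b k j * z j := by
        rw [Finset.mul_sum]
        exact Finset.sum_congr rfl fun j _ => by ring
      have h5 : ∑ j, (A k j + e ^ 2 * b k j) * z j =
          ∑ j, A k j * z j + e ^ 2 * ∑ j, b k j * z j := by
        rw [Finset.mul_sum, ← Finset.sum_add_distrib]
        exact Finset.sum_congr rfl fun j _ => by ring
      rw [h4, h5]
      ring
    rw [h2, hz, mul_zero, Pi.zero_apply]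
  -- `A * adj A = e`, and `e` cancels in a domain.
  have hev : e • v = 0 := by
    have := congrArg A.mulVec hzero
    rwa [Matrix.mulVec_mulVec, Matrix.mul_adjugate, hdet, Matrix.smul_mulVec, Matrix.one_mulVec,
      Matrix.mulVec_zero] at this
  intro i
  simpa [he0] using congrFun hev i

/-- Differences of solutions are controlled by the differences of their first blocks. -/
theorem exists_mul_sub_eq_sum [IsLocalRing R]
    (p : Fin s → MvPolynomial (Fin (r + s)) R) {e : R}
    (he : e = eval 0 (jacobianMinor p)) {u u' : Fin r → R} {w w' : Fin s → R}
    (hu : ∀ i, u i ∈ e ^ 2 • maximalIdeal R) (hu' : ∀ i, u' i ∈ e ^ 2 • maximalIdeal R)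
    (hw : ∀ j, w j ∈ e • maximalIdeal R) (hw' : ∀ j, w' j ∈ e • maximalIdeal R)
    (h : ∀ i, eval (Fin.append u w) (p i) = 0) (h' : ∀ i, eval (Fin.append u' w') (p i) = 0)
    (j : Fin s) : ∃ c : Fin r → R, e * (w j - w' j) = ∑ i, c i * (u i - u' i) := by
  have hx := append_mem (fun i => sq_smul_le e _ (hu i)) hw
  have hx' := append_mem (fun i => sq_smul_le e _ (hu' i)) hw'
  choose N hN hNm using fun k => exists_eval_sub_eval_eq_sum _ hx hx' (p k)
  let M : Matrix (Fin s) (Fin s) R := Matrix.of fun k j => N k (Fin.natAdd r j)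
  -- `M` agrees with the Jacobian matrix modulo `e 𝔪`, so `det M = e (1 + t)` with `t ∈ 𝔪`.
  have hdet := det_sub_det_mem _ (M := M) (fun k j => hNm k (Fin.natAdd r j))
  obtain ⟨t, ht, hdet⟩ := mem_smul_ideal.mp hdet
  change e * t = M.det -
    (Matrix.of fun i j : Fin s => eval 0 (pderiv (Fin.natAdd r j) (p i))).det at hdet
  rw [← eval_zero_jacobianMinor, ← he] at hdet
  have hd : IsUnit (1 + t) := by
    by_contra hn
    have := (maximalIdeal R).sub_mem ((mem_maximalIdeal _).mpr hn) ht
    rw [add_sub_cancel_right] at this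
    exact (mem_maximalIdeal _).mp this isUnit_one
  obtain ⟨d, hd⟩ := hd.exists_left_inv
  let g : Fin s → R := fun k => ∑ i, N k (Fin.castAdd s i) * (u i - u' i)
  have hM : M.mulVec (w - w') = -g := by
    ext k
    have := hN k
    rw [h, h', sub_zero, Fin.sum_univ_add] at this
    simp only [Fin.append_left, Fin.append_right] at this
    exact (neg_eq_of_add_eq_zero_right this.symm).symm
  have hMM := congrFun (congrArg M.adjugate.mulVec hM) j
  rw [Matrix.mulVec_mulVec, Matrix.adjugate_mul, Matrix.smul_mulVec, Matrix.one_mulVec] at hMM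
  refine ⟨fun i => d * ∑ k, M.adjugate j k * -N k (Fin.castAdd s i), ?_⟩
  have h3 : e * (w j - w' j) = d * (M.det • (w - w')) j := by
    rw [Pi.smul_apply, smul_eq_mul, Pi.sub_apply, show M.det = e * (1 + t) by linear_combination -hdet]
    linear_combination -(e * (w j - w' j)) * hd
  rw [h3, hMM]
  simp only [Matrix.mulVec, dotProduct, Pi.neg_apply, g, Finset.mul_sum, Finset.sum_mul,
    ← Finset.sum_neg_distrib]
  rw [Finset.sum_comm]
  refine Finset.sum_congr rfl fun i _ => Finset.sum_congr rfl fun k _ => by ring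

end Algebra

end HenselianIFT

namespace HenselianIFT

/-! ### Multiples of the maximal ideal as open balls -/

section Topology

variable {K : Type*} [Field K] {Γ₀ : Type*} [LinearOrderedCommGroupWithZero Γ₀] [Valued K Γ₀]

theorem mem_smul_maximalIdeal_iff {a : 𝒪[K]} (ha : a ≠ 0) {x : 𝒪[K]} :
    x ∈ a • 𝓂[K] ↔ Valued.v (x : K) < Valued.v (a : K) := by
  have haK : (a : K) ≠ 0 := fun h => ha (Subtype.ext h)
  have hva : 0 < Valued.v (a : K) := (Valuation.pos_iff _).mpr haK
  have hmem : ∀ y : 𝒪[K], y ∈ 𝓂[K] ↔ Valued.v (y : K) < 1 := fun y =>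
    (IsLocalRing.mem_maximalIdeal y).trans Valuation.Integer.not_isUnit_iff_valuation_lt_one
  rw [mem_smul_ideal]
  constructor
  · rintro ⟨y, hy, rfl⟩
    rw [Subring.coe_mul, map_mul]
    exact mul_lt_of_lt_one_right hva ((hmem y).mp hy)
  · intro h
    have hlt : Valued.v ((x : K) / a) < 1 := by
      rw [map_div₀]
      exact (div_lt_one₀ hva).mpr h
    exact ⟨⟨(x : K) / a, hlt.le⟩, (hmem _).mpr hlt, Subtype.ext (mul_div_cancel₀ _ haK)⟩

theorem isOpen_smul_maximalIdeal {a : 𝒪[K]} (ha : a ≠ 0) :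
    IsOpen {x : 𝒪[K] | x ∈ a • 𝓂[K]} := by
  have h := (Valued.isOpen_ball K (Valued.v.restrict (a : K))).preimage
    (continuous_subtype_val (p := (· ∈ 𝒪[K])))
  convert h using 1
  ext x
  exact (mem_smul_maximalIdeal_iff ha).trans (Valuation.restrict_lt_iff _).symm

end Topology

end HenselianIFT

open HenselianIFT in
/-- Implicit function theorem over the valuation ring `R = 𝒪[K]` of a Henselian valued field `K`,
with maximal ideal `𝓂[K]`. All spaces carry the (subspace and product topologies of the)
valuation topology; `a • 𝓂[K]` is the ideal `{a x : x ∈ 𝓂[K]}`. -/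
theorem mainTheorem1 {K : Type*} [Field K] {Γ₀ : Type*} [LinearOrderedCommGroupWithZero Γ₀]
    [Valued K Γ₀] [HenselianLocalRing 𝒪[K]] (r s : ℕ)
    (p : Fin s → MvPolynomial (Fin (r + s)) 𝒪[K])
    (hV : (0 : Fin (r + s) → 𝒪[K]) ∈ HenselianIFT.zeroLocus p)
    (e : 𝒪[K])
    (he : e = MvPolynomial.eval (0 : Fin (r + s) → 𝒪[K]) (HenselianIFT.jacobianMinor p))
    (he0 : e ≠ 0) :
    ∃ φ : (Fin r → ↥(e ^ 2 • 𝓂[K])) → (Fin s → ↥(e • 𝓂[K])),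
      Continuous φ ∧ φ 0 = 0 ∧
      ∃ hφ : ∀ u, HenselianIFT.joinPoint u (φ u) ∈ HenselianIFT.zeroLocus p,
        Topology.IsOpenEmbedding
          (fun u => (⟨HenselianIFT.joinPoint u (φ u), hφ u⟩ : HenselianIFT.zeroLocus p)) := by
  have heK : (e : K) ≠ 0 := fun h => he0 (Subtype.ext h)
  have hex : ∀ u : Fin r → ↥(e ^ 2 • 𝓂[K]), ∃ w : Fin s → ↥(e • 𝓂[K]),
      joinPoint u w ∈ zeroLocus p := fun u => by
    obtain ⟨w, hw, hw0⟩ := exists_solution p hV he he0 (fun i => (u i : 𝒪[K])) fun i => (u i).2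
    exact ⟨fun j => ⟨w j, hw j⟩, hw0⟩
  have hdiff : ∀ (u u' : Fin r → ↥(e ^ 2 • 𝓂[K])) (w w' : Fin s → ↥(e • 𝓂[K])),
      joinPoint u w ∈ zeroLocus p → joinPoint u' w' ∈ zeroLocus p → ∀ j, ∃ c : Fin r → 𝒪[K],
        e * ((w j : 𝒪[K]) - w' j) = ∑ i, c i * ((u i : 𝒪[K]) - u' i) :=
    fun u u' w w' h h' j => exists_mul_sub_eq_sum p he (fun i => (u i).2) (fun i => (u' i).2)
      (fun j => (w j).2) (fun j => (w' j).2) h h' j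
  have huniq : ∀ (u : Fin r → ↥(e ^ 2 • 𝓂[K])) (w w' : Fin s → ↥(e • 𝓂[K])),
      joinPoint u w ∈ zeroLocus p → joinPoint u w' ∈ zeroLocus p → w = w' := by
    intro u w w' h h'
    ext1 j
    obtain ⟨c, hc⟩ := hdiff u u w w' h h' j
    simp only [sub_self, mul_zero, Finset.sum_const_zero, mul_eq_zero, he0, false_or] at hc
    exact Subtype.ext (sub_eq_zero.mp hc)
  choose φ hφ using hex
  have hcoe : ∀ i, Continuous fun u : Fin r → ↥(e ^ 2 • 𝓂[K]) => ((u i : 𝒪[K]) : K) := fun i =>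
    continuous_subtype_val.comp (continuous_subtype_val.comp (continuous_apply i))
  have hcont : Continuous φ := by
    refine continuous_pi fun j => Continuous.subtype_mk (p := (· ∈ e • 𝓂[K]))
      (Continuous.subtype_mk (p := (· ∈ 𝒪[K])) (f := fun u => ((φ u j : 𝒪[K]) : K)) ?_ _) _
    refine continuous_iff_continuousAt.mpr fun u₀ => Filter.tendsto_def.mpr fun S hS => ?_
    obtain ⟨γ, hγ⟩ := Valued.mem_nhds.mp hS
    have hve : Valued.v.restrict (e : K) ≠ 0 := (Valuation.ne_zero_iff _).mpr heK
    -- The radius `v(e) γ` absorbs the factor `e` in `hdiff`.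
    have hnhds : ∀ i, ∀ᶠ u in nhds u₀,
        Valued.v.restrict (((u i : 𝒪[K]) : K) - (u₀ i : 𝒪[K])) <
          Valued.v.restrict (e : K) * γ := fun i =>
      (hcoe i).continuousAt.eventually
        (Valued.mem_nhds.mpr ⟨Units.mk0 _ hve * γ, fun y hy => by simpa using hy⟩)
    filter_upwards [Filter.eventually_all.mpr hnhds] with u hu
    refine hγ ?_
    obtain ⟨c, hc⟩ := hdiff u u₀ _ _ (hφ u) (hφ u₀) j
    have hcK := congrArg (fun x : 𝒪[K] => (x : K)) hc
    simp only [Subring.coe_mul, AddSubgroupClass.coe_sub, AddSubmonoidClass.coe_finsetSum] at hcK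
    have hlt : Valued.v.restrict ((e : K) * ((φ u j : 𝒪[K]) - (φ u₀ j : 𝒪[K]))) <
        Valued.v.restrict (e : K) * γ := by
      rw [hcK]
      refine Valuation.map_sum_lt _ (mul_ne_zero hve γ.ne_zero) fun i _ => ?_
      rw [map_mul]
      exact mul_lt_of_le_one_of_lt ((Valuation.restrict_le_one_iff _).mpr (c i).2) (hu i)
    rw [map_mul] at hlt
    exact lt_of_mul_lt_mul_left' hlt
  refine ⟨φ, hcont, ?_, hφ, ?_⟩
  · refine huniq 0 _ _ (hφ 0) ?_
    convert hV
    ext1 k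
    induction k using Fin.addCases <;> simp [joinPoint]
  · have hgc : Continuous fun u => (⟨joinPoint u (φ u), hφ u⟩ : zeroLocus p) := by
      refine Continuous.subtype_mk (continuous_pi fun k => ?_) _
      induction k using Fin.addCases with
      | left i =>
        simp only [joinPoint, Fin.append_left]
        exact continuous_subtype_val.comp (continuous_apply i)
      | right j =>
        simp only [joinPoint, Fin.append_right]
        exact continuous_subtype_val.comp ((continuous_apply j).comp hcont)
    have hproj : Continuous fun (x : zeroLocus p) (i : Fin r) => x.1 (Fin.castAdd s i) :=
      continuous_pi fun i => (continuous_apply _).comp continuous_subtype_val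
    -- Projecting the graph to its first block gives the inclusion of `(e² 𝔪)^r` in `R^r`, an
    -- embedding.
    refine ⟨Topology.IsEmbedding.of_comp hgc hproj ?_, ?_⟩
    · convert Topology.IsEmbedding.piMap
        (fun _ : Fin r => Topology.IsEmbedding.subtypeVal (p := (· ∈ e ^ 2 • 𝓂[K]))) using 1
      ext u i
      simp [joinPoint]
    · have hrange : Set.range (fun u => (⟨joinPoint u (φ u), hφ u⟩ : zeroLocus p)) =
          (⋂ i : Fin r, {x : zeroLocus p | x.1 (Fin.castAdd s i) ∈ e ^ 2 • 𝓂[K]}) ∩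
            ⋂ j : Fin s, {x : zeroLocus p | x.1 (Fin.natAdd r j) ∈ e • 𝓂[K]} := by
        ext x
        simp only [Set.mem_range, Set.mem_inter_iff, Set.mem_iInter, Set.mem_ofPred_eq]
        constructor
        · rintro ⟨u, rfl⟩
          exact ⟨fun i => by simp [joinPoint], fun j => by simp [joinPoint]⟩
        · rintro ⟨h1, h2⟩
          let u : Fin r → ↥(e ^ 2 • 𝓂[K]) := fun i => ⟨_, h1 i⟩
          let w : Fin s → ↥(e • 𝓂[K]) := fun j => ⟨_, h2 j⟩
          have hx : joinPoint u w = x.1 := by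
            ext1 k
            induction k using Fin.addCases <;> simp [joinPoint, u, w]
          have hw : φ u = w := huniq u _ _ (hφ u) (hx ▸ x.2)
          exact ⟨u, Subtype.ext ((congrArg (joinPoint u) hw).trans hx)⟩
      have hproj' : ∀ k, Continuous fun x : zeroLocus p => x.1 k := fun k =>
        (continuous_apply k).comp continuous_subtype_val
      rw [hrange]
      exact (isOpen_iInter_of_finite fun i =>
        (isOpen_smul_maximalIdeal (pow_ne_zero 2 he0)).preimage (hproj' _)).inter
        (isOpen_iInter_of_finite fun j => (isOpen_smul_maximalIdeal he0).preimage (hproj' _))
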